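/- **Setting.** Let $M$ be a globally hyperbolic spacetime: a smooth oriented and time-oriented Lorentzian manifold (Hausdorff, second countable, signature $+-\cdots-$) without closed causal curves, in which $\mathrm{ch}(S)=J^+(S)\cap J^-(S)$ is compact for every compact $S$. A *region* is an open set $O$ with $\mathrm{ch}(O)=O$. A *QFT* $\mathscr A$ on $M$ is a unital complex $*$-algebra $\mathscr A(M)$ with unital $*$-subalgebras $\mathscr A(M;O)$ for all regions $O$, such that $\mathscr A(M;M)=\mathscr A(M)$, $\mathscr A(M;O_1)\subset\mathscr A(M;O_2)$ if $O_1\subset O_2$, with equality if moreover $O_1$ contains a Cauchy surface of $M$, and such that $\mathscr A(M;O_1)$ and $\mathscr A(M;O_2)$ commute if $O_1\cap J(O_2)=\emptyset$. The algebraic tensor product $\mathscr A\otimes\mathscr B$ has local algebras $\mathscr A(M;O)\otimes\mathscr B(M;O)$. A QFT $\mathscr C$ is a *coupled combination* of $\mathscr A$ and $\mathscr B$ with coupling zone $K$, where $K\subset M$ is temporally compact (closed and contained between two Cauchy surfaces), if there are given unital $*$-isomorphisms $\iota_O:(\mathscr A\otimes\mathscr B)(M;O)\to\mathscr C(M;O)$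 for all regions $O\subset M\setminus\mathrm{ch}(K)$ that are compatible with the inclusions for $O_1\subset O_2$. With $M^\pm=M\setminus J^\mp(K)$, $\iota_{M^\pm}$ and the timeslice property define isomorphisms $\tau^\pm:\mathscr A(M)\otimes\mathscr B(M)\to\mathscr C(M)$; the *scattering map* is $\Theta=(\tau^-)^{-1}\circ\tau^+$. For a state $\sigma$ on $\mathscr B(M)$ (a linear functional with $\sigma(1)=1$ and $\sigma(B^*B)\ge0$) and an effect $F\in\mathrm{Eff}(\mathscr B(M))$ (both $F$ and $1-F$ are finite sums of elements $B^*B$), the *pre-instrument* $\mathscr I_\sigma(F)$ is the linear map on the algebraic dual $\mathscr A(M)^*$ given by $$\mathscr I_\sigma(F)(\omega)(A)=\omega\bigl(\eta_\sigma(\Theta(A\otimes F))\bigr),\qquad \eta_\sigma(A\otimes B)=\sigma(B)A .$$ The *selective update* of a state $\omega$ by $F$ is the state $\mathscr I_\sigma(F)(\omega)/\mathscr I_\sigma(F)(\omega)(1)$, defined if $\mathscr I_\sigma(F)(\omega)(1)\ne0$; the *nonselective update* is the state $\mathscr I_\sigma(1)(\omega)$. **Hypotheses.** Let $\mathscr A,\mathscr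 B_1,\mathscr B_2$ be QFTs on $M$, let $\mathscr C_j$ be a coupled combination of $\mathscr A$ and $\mathscr B_j$ with coupling zone $K_j$ and scattering map $\Theta_j$ ($j=1,2$), and let $\mathscr C$ be a coupled combination of $\mathscr A$ and $\mathscr B_1\otimes\mathscr B_2$ with coupling zone $K_1\cup K_2$ and scattering map $\Theta$. Write $K_i\triangleleft K_j$ if $K_i\cap J^+(K_j)=\emptyset$. Assume *causal factorisation*, for each causal order that the coupling zones admit: if $K_1\triangleleft K_2$ then $\Theta=(\Theta_1\otimes\mathrm{id})\circ(\Theta_2\otimes_2\mathrm{id})$, and if $K_2\triangleleft K_1$ then $\Theta=(\Theta_2\otimes_2\mathrm{id})\circ(\Theta_1\otimes\mathrm{id})$, as maps on $\mathscr A(M)\otimes\mathscr B_1(M)\otimes\mathscr B_2(M)$, where $\Theta_1\otimes\mathrm{id}$ acts on the factors $\mathscr A(M),\mathscr B_1(M)$ and $\Theta_2\otimes_2\mathrm{id}$ on the factors $\mathscr A(M),\mathscr B_2(M)$. **Claim.** If $K_1$ and $K_2$ are causally disjoint ($K_1\cap J(K_2)=\emptyset$), then for all states $\sigma_j$ on $\mathscr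 B_j(M)$ and all effects $E_j\in\mathrm{Eff}(\mathscr B_j(M))$, $$\mathscr I_{\sigma_2}(E_2)\circ\mathscr I_{\sigma_1}(E_1)=\mathscr I_{\sigma_1\otimes\sigma_2}(E_1\otimes E_2)=\mathscr I_{\sigma_1}(E_1)\circ\mathscr I_{\sigma_2}(E_2).$$ Consequently, the selective updates by $E_1$ and by $E_2$ can be performed in either order, or as the single selective update by $E_1\otimes E_2$: as partially defined maps on the states of $\mathscr A(M)$, the two compositions and the combined update have the same domain and the same values. Likewise, the nonselective updates of the two measurements, composed in either order, equal the nonselective update of the combined measurement. -/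

import Mathlib

open scoped TensorProduct Manifold ContDiff Topology ComplexOrder
open Bundle

noncomputable section

namespace AQFT

/-! ### Lorentzian spacetimes and their causal structure -/

/-- The geometric data of a `(d+1)`-dimensional spacetime on a smooth manifold `M`: a smooth Lorentzian
metric of signature `(+, -, …, -)`, an orientation and a time orientation. -/
structure Spacetime (d : ℕ) (M : Type*) [TopologicalSpace M]
    [ChartedSpace (EuclideanSpace ℝ (Fin (d + 1))) M] [IsManifold (𝓡 (d + 1)) ∞ M] where
  /-- The metric tensor. -/
  metric (p : M) :
    TangentSpace (𝓡 (d + 1)) p →L[ℝ] TangentSpace (𝓡 (d + 1)) p →L[ℝ] ℝ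
  metric_symm (p : M) (v w : TangentSpace (𝓡 (d + 1)) p) : metric p v w = metric p w v
  metric_smooth : ContMDiff (𝓡 (d + 1))
    ((𝓡 (d + 1)).prod 𝓘(ℝ, EuclideanSpace ℝ (Fin (d + 1)) →L[ℝ]
      EuclideanSpace ℝ (Fin (d + 1)) →L[ℝ] ℝ)) ∞
    (fun p ↦ TotalSpace.mk' (EuclideanSpace ℝ (Fin (d + 1)) →L[ℝ]
      EuclideanSpace ℝ (Fin (d + 1)) →L[ℝ] ℝ) p (metric p))
  /-- Every tangent space has an orthonormal basis with one vector of square `+1` and all the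
  others of square `-1`. -/
  signature (p : M) : ∃ b : Module.Basis (Fin (d + 1)) ℝ (TangentSpace (𝓡 (d + 1)) p),
    ∀ i j, metric p (b i) (b j) = if i = j then (if i = 0 then 1 else -1) else 0
  /-- The orientation, a choice of orientation in every tangent space ... -/
  orientation (p : M) : Orientation ℝ (TangentSpace (𝓡 (d + 1)) p) (Fin (d + 1))
  /-- ... which is locally constant in the local trivialisations of the tangent bundle. -/
  orientation_locallyConstant (p : M) : ∀ᶠ q in 𝓝 p,
    ∀ (hp : p ∈ (trivializationAt (EuclideanSpace ℝ (Fin (d + 1)))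
        (TangentSpace (𝓡 (d + 1)) : M → Type _) p).baseSet)
      (hq : q ∈ (trivializationAt (EuclideanSpace ℝ (Fin (d + 1)))
        (TangentSpace (𝓡 (d + 1)) : M → Type _) p).baseSet),
      Orientation.map (Fin (d + 1))
          ((trivializationAt (EuclideanSpace ℝ (Fin (d + 1)))
            (TangentSpace (𝓡 (d + 1)) : M → Type _) p).linearEquivAt ℝ q hq) (orientation q) =
        Orientation.map (Fin (d + 1))
          ((trivializationAt (EuclideanSpace ℝ (Fin (d + 1)))
            (TangentSpace (𝓡 (d + 1)) : M → Type _) p).linearEquivAt ℝ p hp) (orientation p)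
  /-- The time orientation, given by a smooth timelike vector field declared to be
  future-directed. -/
  timeField (p : M) : TangentSpace (𝓡 (d + 1)) p
  timeField_smooth : ContMDiff (𝓡 (d + 1))
    ((𝓡 (d + 1)).prod 𝓘(ℝ, EuclideanSpace ℝ (Fin (d + 1)))) ∞
    (fun p ↦ TotalSpace.mk' (EuclideanSpace ℝ (Fin (d + 1))) p (timeField p))
  timeField_timelike (p : M) : 0 < metric p (timeField p) (timeField p)

namespace Spacetime

variable {d : ℕ} {M : Type*} [TopologicalSpace M]
  [ChartedSpace (EuclideanSpace ℝ (Fin (d + 1))) M] [IsManifold (𝓡 (d + 1)) ∞ M]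
  (S : Spacetime d M)

/-- Future-directed causal (timelike or null, nonzero) tangent vectors. -/
def IsFutureCausal (p : M) (v : TangentSpace (𝓡 (d + 1)) p) : Prop :=
  v ≠ 0 ∧ 0 ≤ S.metric p v v ∧ 0 < S.metric p (S.timeField p) v

/-- Future-directed timelike tangent vectors. -/
def IsFutureTimelike (p : M) (v : TangentSpace (𝓡 (d + 1)) p) : Prop :=
  0 < S.metric p v v ∧ 0 < S.metric p (S.timeField p) v

/-- There is a smooth future-directed causal curve segment from `p` to `q`. -/
def SmoothCausalSegment (p q : M) : Prop :=
  ∃ γ : ℝ → M, ContMDiffOn 𝓘(ℝ, ℝ) (𝓡 (d + 1)) ∞ γ (Set.Icc 0 1) ∧ γ 0 = p ∧ γ 1 = q ∧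
    ∀ t ∈ Set.Icc (0 : ℝ) 1, S.IsFutureCausal (γ t)
      (mfderivWithin 𝓘(ℝ, ℝ) (𝓡 (d + 1)) γ (Set.Icc 0 1) t (1 : ℝ))

/-- There is a piecewise smooth future-directed causal curve from `p` to `q`, i.e. a finite
concatenation of (at least one) smooth segments. -/
def CausalCurve : M → M → Prop := Relation.TransGen S.SmoothCausalSegment

/-- The causal future `J⁺(X)`, which contains `X`. -/
def JPlus (X : Set M) : Set M := {q | q ∈ X ∨ ∃ p ∈ X, S.CausalCurve p q}

/-- The causal past `J⁻(X)`, which contains `X`. -/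
def JMinus (X : Set M) : Set M := {p | p ∈ X ∨ ∃ q ∈ X, S.CausalCurve p q}

/-- `J(X) = J⁺(X) ∪ J⁻(X)`. -/
def J (X : Set M) : Set M := S.JPlus X ∪ S.JMinus X

/-- The causal hull `J⁺(X) ∩ J⁻(X)`. -/
def causalHull (X : Set M) : Set M := S.JPlus X ∩ S.JMinus X

/-- No closed causal curves, and every compact set has a compact causal hull. -/
structure IsGloballyHyperbolic : Prop where
  not_closed (p : M) : ¬ S.CausalCurve p p
  isCompact_causalHull (X : Set M) : IsCompact X → IsCompact (S.causalHull X)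

/-- A region is an open causally convex subset. -/
def IsRegion (O : Set M) : Prop := IsOpen O ∧ S.causalHull O = O

/-- `X` and `Y` are causally disjoint. -/
def CausallyDisjoint (X Y : Set M) : Prop := X ∩ S.J Y = ∅

/-- The causal order `X ◁ Y`: `X` does not meet the causal future of `Y`. -/
def CausallyPrecedes (X Y : Set M) : Prop := X ∩ S.JPlus Y = ∅

/-- An inextendible smooth future-directed timelike curve, with parameter domain normalised
to `ℝ`; it has no limit point in `M` at either end. -/
structure IsInextendibleTimelikeCurve (γ : ℝ → M) : Prop where
  smooth : ContMDiff 𝓘(ℝ, ℝ) (𝓡 (d + 1)) ∞ γ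
  timelike (t : ℝ) : S.IsFutureTimelike (γ t) (mfderiv 𝓘(ℝ, ℝ) (𝓡 (d + 1)) γ t (1 : ℝ))
  no_future_endpoint : ¬ ∃ p, Filter.Tendsto γ Filter.atTop (𝓝 p)
  no_past_endpoint : ¬ ∃ p, Filter.Tendsto γ Filter.atBot (𝓝 p)

/-- A Cauchy surface is met exactly once by every inextendible timelike curve. -/
def IsCauchySurface (X : Set M) : Prop :=
  ∀ γ : ℝ → M, S.IsInextendibleTimelikeCurve γ → ∃! t : ℝ, γ t ∈ X

/-- Temporally compact: closed and contained between two Cauchy surfaces. -/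
def IsTemporallyCompact (K : Set M) : Prop :=
  IsClosed K ∧ ∃ X Y : Set M, S.IsCauchySurface X ∧ S.IsCauchySurface Y ∧
    K ⊆ S.JPlus X ∩ S.JMinus Y

/-- The natural "out" region `M⁺ = M \ J⁻(K)`. -/
def outRegion (K : Set M) : Set M := (S.JMinus K)ᶜ

/-- The natural "in" region `M⁻ = M \ J⁺(K)`. -/
def inRegion (K : Set M) : Set M := (S.JPlus K)ᶜ

/-- A region of the spacetime that contains a Cauchy surface of the whole spacetime. -/
def IsCauchyRegion (O : Set M) : Prop :=
  S.IsRegion O ∧ ∃ X, S.IsCauchySurface X ∧ X ⊆ O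

theorem outRegion_subset (K : Set M) : S.outRegion K ⊆ (S.causalHull K)ᶜ :=
  Set.compl_subset_compl.2 Set.inter_subset_right

theorem inRegion_subset (K : Set M) : S.inRegion K ⊆ (S.causalHull K)ᶜ :=
  Set.compl_subset_compl.2 Set.inter_subset_left

theorem isRegion_univ : S.IsRegion Set.univ :=
  ⟨isOpen_univ, Set.eq_univ_of_forall fun _ ↦ ⟨Or.inl trivial, Or.inl trivial⟩⟩

end Spacetime

/-! ### Unital `*`-algebras: positive elements, effects, states, tensor products -/

section StarAlgebra

set_option linter.unusedSectionVars false

variable {𝒜 ℬ : Type*} [Ring 𝒜] [StarRing 𝒜] [Algebra ℂ 𝒜] [StarModule ℂ 𝒜]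
  [Ring ℬ] [StarRing ℬ] [Algebra ℂ ℬ] [StarModule ℂ ℬ]

/-- `x` is positive: a finite sum of elements of the form `a* a`. -/
def IsPos (x : 𝒜) : Prop := x ∈ AddSubmonoid.closure (Set.range fun a : 𝒜 ↦ star a * a)

theorem isPos_one : IsPos (1 : 𝒜) := AddSubmonoid.subset_closure ⟨1, by simp⟩

theorem isPos_zero : IsPos (0 : 𝒜) := AddSubmonoid.zero_mem _

theorem IsPos.add {x y : 𝒜} (hx : IsPos x) (hy : IsPos y) : IsPos (x + y) :=
  AddSubmonoid.add_mem _ hx hy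

theorem IsPos.tmul {x : 𝒜} {y : ℬ} (hx : IsPos x) (hy : IsPos y) :
    IsPos (x ⊗ₜ[ℂ] y : 𝒜 ⊗[ℂ] ℬ) := by
  induction hx using AddSubmonoid.closure_induction with
  | zero => simpa using isPos_zero (𝒜 := 𝒜 ⊗[ℂ] ℬ)
  | add u v _ _ hu hv => rw [TensorProduct.add_tmul]; exact hu.add hv
  | mem u hu =>
    obtain ⟨a, rfl⟩ := hu
    induction hy using AddSubmonoid.closure_induction with
    | zero => simpa using isPos_zero (𝒜 := 𝒜 ⊗[ℂ] ℬ)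
    | add u v _ _ hu hv => rw [TensorProduct.tmul_add]; exact hu.add hv
    | mem v hv =>
      obtain ⟨b, rfl⟩ := hv
      exact AddSubmonoid.subset_closure ⟨a ⊗ₜ b, by simp [TensorProduct.star_tmul]⟩

variable (𝒜) in
/-- Effects: elements `E` with `E ≥ 0` and `1 - E ≥ 0`. -/
structure Effect where
  /-- The underlying algebra element. -/
  val : 𝒜
  pos : IsPos val
  compl_pos : IsPos (1 - val)

variable (𝒜) in
/-- The trivially passed test. -/
def Effect.one : Effect 𝒜 := ⟨1, isPos_one, by simpa using isPos_zero⟩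

/-- The effect `E ⊗ F` (the test `E & F`). -/
def Effect.tensor (E : Effect 𝒜) (F : Effect ℬ) : Effect (𝒜 ⊗[ℂ] ℬ) where
  val := E.val ⊗ₜ F.val
  pos := E.pos.tmul F.pos
  compl_pos := by
    have h : (1 : 𝒜 ⊗[ℂ] ℬ) - E.val ⊗ₜ F.val = (1 - E.val) ⊗ₜ 1 + E.val ⊗ₜ (1 - F.val) := by
      rw [TensorProduct.sub_tmul, TensorProduct.tmul_sub, Algebra.TensorProduct.one_def]; abel
    rw [h]
    exact (E.compl_pos.tmul isPos_one).add (E.pos.tmul F.compl_pos)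

variable (𝒜) in
/-- States: normalised positive linear functionals. -/
structure State where
  /-- The underlying linear functional. -/
  toDual : Module.Dual ℂ 𝒜
  map_one : toDual 1 = 1
  nonneg (a : 𝒜) : 0 ≤ toDual (star a * a)

/-- `φ ⊗ σ` as a linear functional. -/
def tensorDual (φ : Module.Dual ℂ 𝒜) (σ : Module.Dual ℂ ℬ) : Module.Dual ℂ (𝒜 ⊗[ℂ] ℬ) :=
  LinearMap.mul' ℂ ℂ ∘ₗ TensorProduct.map φ σ

@[simp] theorem tensorDual_tmul (φ : Module.Dual ℂ 𝒜) (σ : Module.Dual ℂ ℬ) (a : 𝒜) (b : ℬ) :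
    tensorDual φ σ (a ⊗ₜ b) = φ a * σ b := by simp [tensorDual]

theorem State.conj_apply (φ : State 𝒜) (a b : 𝒜) :
    star (φ.toDual (star a * b)) = φ.toDual (star b * a) := by
  have key (x : 𝒜) : (φ.toDual (star x * x)).im = 0 := ((Complex.nonneg_iff.1 (φ.nonneg x)).2).symm
  have h₁ := key (a + b)
  have h₂ := key (a + Complex.I • b)
  have ha := key a
  have hb := key b
  simp only [star_add, star_smul, add_mul, mul_add, map_add, smul_mul_assoc, mul_smul_comm, map_smul,
    Complex.add_im, smul_eq_mul, Complex.mul_im, Complex.mul_re, Complex.I_re, Complex.I_im,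
    RCLike.star_def, Complex.conj_I, Complex.neg_re, Complex.neg_im, ha, hb] at h₁ h₂
  apply Complex.ext
  · simp only [RCLike.star_def, Complex.conj_re]; linarith
  · simp only [RCLike.star_def, Complex.conj_im]; linarith

theorem State.posSemidef {n : Type*} [Fintype n] (φ : State 𝒜) (a : n → 𝒜) :
    (Matrix.of fun i j ↦ φ.toDual (star (a i) * a j)).PosSemidef := by
  refine Matrix.posSemidef_iff_dotProduct_mulVec.2 ⟨?_, fun x ↦ ?_⟩
  · ext i j
    exact φ.conj_apply _ _
  · have h := φ.nonneg (∑ i, x i • a i)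
    rw [star_sum, Finset.sum_mul_sum] at h
    convert h using 1
    simp only [dotProduct, Matrix.mulVec, Matrix.of_apply, star_smul,
      smul_mul_smul_comm, map_sum, map_smul, smul_eq_mul, Finset.mul_sum, Pi.star_apply]
    exact Finset.sum_congr rfl fun i _ ↦ Finset.sum_congr rfl fun j _ ↦ by ring

theorem tensorDual_nonneg (φ : State 𝒜) (σ : State ℬ) (c : 𝒜 ⊗[ℂ] ℬ) :
    0 ≤ tensorDual φ.toDual σ.toDual (star c * c) := by
  obtain ⟨X, rfl⟩ := TensorProduct.exists_finset c
  have h := ((φ.posSemidef fun i : X ↦ i.1.1).hadamard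
    (σ.posSemidef fun i : X ↦ i.1.2)).dotProduct_mulVec_nonneg (fun _ ↦ 1)
  convert h using 1
  rw [← Finset.sum_coe_sort X]
  simp only [dotProduct, Matrix.mulVec, Matrix.of_apply, Matrix.hadamard_apply, star_sum,
    Finset.sum_mul_sum, TensorProduct.star_tmul, Algebra.TensorProduct.tmul_mul_tmul, map_sum,
    tensorDual_tmul, Pi.star_apply, star_one, one_mul, mul_one]

/-- The product state. -/
def State.tensor (φ : State 𝒜) (σ : State ℬ) : State (𝒜 ⊗[ℂ] ℬ) where
  toDual := tensorDual φ.toDual σ.toDual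
  map_one := by
    rw [Algebra.TensorProduct.one_def, tensorDual_tmul, φ.map_one, σ.map_one, one_mul]
  nonneg := tensorDual_nonneg φ σ

/-- The algebraic tensor product of two `*`-subalgebras, as a `*`-subalgebra of the tensor
product. -/
def tensorSubalgebra (P : StarSubalgebra ℂ 𝒜) (Q : StarSubalgebra ℂ ℬ) :
    StarSubalgebra ℂ (𝒜 ⊗[ℂ] ℬ) where
  toSubalgebra := (Algebra.TensorProduct.map P.toSubalgebra.val Q.toSubalgebra.val).range
  star_mem' := by
    rintro _ ⟨x, rfl⟩
    induction x with
    | zero => exact ⟨0, by simp⟩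
    | add x y hx hy =>
      obtain ⟨x', hx'⟩ := hx
      obtain ⟨y', hy'⟩ := hy
      exact ⟨x' + y', by rw [map_add, map_add, star_add, hx', hy']⟩
    | tmul a b =>
      exact ⟨(⟨star a.1, star_mem a.2⟩ : P) ⊗ₜ (⟨star b.1, star_mem b.2⟩ : Q), rfl⟩

/-- The map `η_σ : 𝒜 ⊗ ℬ → 𝒜`, `η_σ (A ⊗ B) = σ(B) A`. -/
def eta (σ : State ℬ) : 𝒜 ⊗[ℂ] ℬ →ₗ[ℂ] 𝒜 :=
  (TensorProduct.rid ℂ 𝒜).toLinearMap ∘ₗ TensorProduct.map LinearMap.id σ.toDual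

end StarAlgebra

/-! ### Quantum field theories and coupled combinations -/

section QFT

variable {d : ℕ} {M : Type*} [TopologicalSpace M]
  [ChartedSpace (EuclideanSpace ℝ (Fin (d + 1))) M] [IsManifold (𝓡 (d + 1)) ∞ M]

/-- A QFT on a spacetime with global unital `*`-algebra `𝒜 = 𝒜(M)`, given by its local algebras
`𝒜(M; O)` for the regions `O`, subject to isotony, Einstein causality and timeslice. -/
structure QFT (S : Spacetime d M) (𝒜 : Type*) [Ring 𝒜] [StarRing 𝒜] [Algebra ℂ 𝒜]
    [StarModule ℂ 𝒜] where
  /-- The local algebras. -/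
  loc (O : Set M) (hO : S.IsRegion O) : StarSubalgebra ℂ 𝒜
  loc_univ : loc Set.univ S.isRegion_univ = ⊤
  isotony (O₁ O₂ : Set M) (h₁ : S.IsRegion O₁) (h₂ : S.IsRegion O₂) :
    O₁ ⊆ O₂ → loc O₁ h₁ ≤ loc O₂ h₂
  einstein_causality (O₁ O₂ : Set M) (h₁ : S.IsRegion O₁) (h₂ : S.IsRegion O₂) :
    S.CausallyDisjoint O₁ O₂ → ∀ a ∈ loc O₁ h₁, ∀ b ∈ loc O₂ h₂, a * b = b * a
  timeslice (O₁ O₂ : Set M) (h₁ : S.IsRegion O₁) (h₂ : S.IsRegion O₂) :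
    O₁ ⊆ O₂ → (∃ X, S.IsCauchySurface X ∧ X ⊆ O₁) → loc O₁ h₁ = loc O₂ h₂

variable {S : Spacetime d M}
  {𝒜 ℬ 𝒞 : Type*} [Ring 𝒜] [StarRing 𝒜] [Algebra ℂ 𝒜] [StarModule ℂ 𝒜]
  [Ring ℬ] [StarRing ℬ] [Algebra ℂ ℬ] [StarModule ℂ ℬ]
  [Ring 𝒞] [StarRing 𝒞] [Algebra ℂ 𝒞] [StarModule ℂ 𝒞]

theorem QFT.loc_eq_top (A : QFT S 𝒜) {O : Set M} (hO : S.IsCauchyRegion O) :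
    A.loc O hO.1 = ⊤ :=
  (A.timeslice O Set.univ hO.1 S.isRegion_univ (Set.subset_univ O) hO.2).trans A.loc_univ

/-- The uncoupled combination `𝒰 = 𝒜 ⊗ ℬ`. -/
def QFT.tensor (A : QFT S 𝒜) (B : QFT S ℬ) : QFT S (𝒜 ⊗[ℂ] ℬ) where
  loc O hO := tensorSubalgebra (A.loc O hO) (B.loc O hO)
  loc_univ := by
    rw [A.loc_univ, B.loc_univ, eq_top_iff]
    rintro x -
    induction x with
    | zero => exact zero_mem _
    | add x y hx hy => exact add_mem hx hy
    | tmul a b => exact ⟨(⟨a, trivial⟩ : (⊤ : StarSubalgebra ℂ 𝒜)) ⊗ₜ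
        (⟨b, trivial⟩ : (⊤ : StarSubalgebra ℂ ℬ)), rfl⟩
  isotony O₁ O₂ h₁ h₂ h := by
    rintro _ ⟨x, rfl⟩
    induction x with
    | zero => simp
    | add x y hx hy =>
      simp only [map_add] at hx hy ⊢
      exact add_mem hx hy
    | tmul a b => exact ⟨(⟨a.1, A.isotony O₁ O₂ h₁ h₂ h a.2⟩ : A.loc O₂ h₂) ⊗ₜ
        (⟨b.1, B.isotony O₁ O₂ h₁ h₂ h b.2⟩ : B.loc O₂ h₂), rfl⟩
  einstein_causality O₁ O₂ h₁ h₂ h := by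
    rintro _ ⟨x, rfl⟩ _ ⟨y, rfl⟩
    induction x with
    | zero => simp
    | add x x' hx hx' => simp only [map_add, add_mul, mul_add] at hx hx' ⊢; rw [hx, hx']
    | tmul a b =>
      induction y with
      | zero => simp
      | add y y' hy hy' => simp only [map_add, add_mul, mul_add] at hy hy' ⊢; rw [hy, hy']
      | tmul a' b' =>
        have ha := A.einstein_causality O₁ O₂ h₁ h₂ h a.1 a.2 a'.1 a'.2
        have hb := B.einstein_causality O₁ O₂ h₁ h₂ h b.1 b.2 b'.1 b'.2
        change (a.1 ⊗ₜ[ℂ] b.1) * (a'.1 ⊗ₜ[ℂ] b'.1) = (a'.1 ⊗ₜ[ℂ] b'.1) * (a.1 ⊗ₜ[ℂ] b.1)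
        rw [Algebra.TensorProduct.tmul_mul_tmul, Algebra.TensorProduct.tmul_mul_tmul, ha, hb]
  timeslice O₁ O₂ h₁ h₂ h hX := by
    rw [A.timeslice O₁ O₂ h₁ h₂ h hX, B.timeslice O₁ O₂ h₁ h₂ h hX]

/-- The data making the QFT `C` a coupled combination of `A` and `B` with temporally compact
coupling zone `K`: unital `*`-isomorphisms `ι_O : 𝒰(M; O) → 𝒞(M; O)` for all regions
`O ⊆ M \ ch(K)`, compatible with isotony. -/
structure CoupledCombination (A : QFT S 𝒜) (B : QFT S ℬ) (C : QFT S 𝒞) (K : Set M) where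
  temporallyCompact : S.IsTemporallyCompact K
  /-- The isomorphisms `ι_O`. -/
  iso (O : Set M) (hO : S.IsRegion O) (hK : O ⊆ (S.causalHull K)ᶜ) :
    (A.tensor B).loc O hO ≃⋆ₐ[ℂ] C.loc O hO
  iso_compatible (O₁ O₂ : Set M) (h₁ : S.IsRegion O₁) (h₂ : S.IsRegion O₂)
    (hK₁ : O₁ ⊆ (S.causalHull K)ᶜ) (hK₂ : O₂ ⊆ (S.causalHull K)ᶜ) (h : O₁ ⊆ O₂)
    (x : (A.tensor B).loc O₁ h₁) :
    (iso O₂ h₂ hK₂ ⟨x.1, (A.tensor B).isotony O₁ O₂ h₁ h₂ h x.2⟩ : 𝒞) = (iso O₁ h₁ hK₁ x : 𝒞)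

variable {A : QFT S 𝒜} {B : QFT S ℬ} {C : QFT S 𝒞} {K : Set M}

/-- The isomorphism `𝒰(M) = 𝒰(M; N) → 𝒞(M; N) = 𝒞(M)` given by `ι_N` and timeslice, for a region
`N ⊆ M \ ch(K)` that contains a Cauchy surface. -/
def CoupledCombination.tau (cc : CoupledCombination A B C K) (N : Set M)
    (hN : S.IsCauchyRegion N) (hK : N ⊆ (S.causalHull K)ᶜ) : 𝒜 ⊗[ℂ] ℬ ≃⋆ₐ[ℂ] 𝒞 where
  toFun x := (cc.iso N hN.1 hK ⟨x, by rw [(A.tensor B).loc_eq_top hN]; trivial⟩ : 𝒞)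
  invFun y := ((cc.iso N hN.1 hK).symm ⟨y, by rw [C.loc_eq_top hN]; trivial⟩ : 𝒜 ⊗[ℂ] ℬ)
  left_inv x := by simp
  right_inv y := by simp
  map_mul' x y := by rw [← MulMemClass.coe_mul, ← map_mul]; rfl
  map_add' x y := by rw [← AddMemClass.coe_add, ← map_add]; rfl
  map_star' x := by rw [← StarMemClass.coe_star, ← map_star]; rfl
  map_smul' r x := by rw [← SetLike.val_smul, ← map_smul]; rfl

open Classical in
/-- The scattering map `Θ = (τ⁻)⁻¹ ∘ τ⁺`, where `τ^±` are the isomorphisms `𝒰(M) → 𝒞(M)` defined by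
the regions `M^± = M \ J^∓(K)`. On a globally hyperbolic spacetime the sets `M^±` are always
regions that contain Cauchy surfaces, so the `else` branch is never taken there. -/
def CoupledCombination.scattering (cc : CoupledCombination A B C K) :
    𝒜 ⊗[ℂ] ℬ ≃⋆ₐ[ℂ] 𝒜 ⊗[ℂ] ℬ :=
  if h : S.IsCauchyRegion (S.outRegion K) ∧ S.IsCauchyRegion (S.inRegion K) then
    (cc.tau (S.outRegion K) h.1 (S.outRegion_subset K)).trans
      (cc.tau (S.inRegion K) h.2 (S.inRegion_subset K)).symm
  else StarAlgEquiv.refl ..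

/-- `Θ` as a linear map. -/
def CoupledCombination.scatteringₗ (cc : CoupledCombination A B C K) :
    𝒜 ⊗[ℂ] ℬ →ₗ[ℂ] 𝒜 ⊗[ℂ] ℬ where
  toFun := cc.scattering
  map_add' := map_add cc.scattering
  map_smul' := map_smul cc.scattering

/-- The linear map `A ↦ η_σ (Θ (A ⊗ F))` on the system algebra. -/
def CoupledCombination.heisenberg (cc : CoupledCombination A B C K) (σ : State ℬ) (F : Effect ℬ) :
    𝒜 →ₗ[ℂ] 𝒜 :=
  eta σ ∘ₗ cc.scatteringₗ ∘ₗ (TensorProduct.mk ℂ 𝒜 ℬ).flip F.val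

/-- The pre-instrument `ℐ_σ : Eff(ℬ) → Lin(𝒜(M)^*)`, with
`ℐ_σ(F)(ω)(A) = ω (η_σ (Θ (A ⊗ F)))`. -/
def CoupledCombination.preInstrument (cc : CoupledCombination A B C K) (σ : State ℬ)
    (F : Effect ℬ) : Module.Dual ℂ 𝒜 →ₗ[ℂ] Module.Dual ℂ 𝒜 :=
  (cc.heisenberg σ F).dualMap

theorem CoupledCombination.preInstrument_apply (cc : CoupledCombination A B C K) (σ : State ℬ)
    (F : Effect ℬ) (φ : Module.Dual ℂ 𝒜) (a : 𝒜) :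
    cc.preInstrument σ F φ a = tensorDual φ σ.toDual (cc.scattering (a ⊗ₜ F.val)) := by
  change φ (eta σ (cc.scattering (a ⊗ₜ F.val))) = _
  induction cc.scattering (a ⊗ₜ F.val) with
  | zero => simp
  | add x y hx hy => rw [map_add, map_add, map_add, hx, hy]
  | tmul x y => simp [eta, mul_comm]

theorem CoupledCombination.preInstrument_nonneg (cc : CoupledCombination A B C K) (σ : State ℬ)
    (F : Effect ℬ) (φ : State 𝒜) (a : 𝒜) : 0 ≤ cc.preInstrument σ F φ.toDual (star a * a) := by
  rw [cc.preInstrument_apply]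
  have hF := F.pos
  generalize F.val = f at hF
  induction hF using AddSubmonoid.closure_induction with
  | zero => simp
  | add u v _ _ hu hv => rw [TensorProduct.tmul_add, map_add, map_add]; exact add_nonneg hu hv
  | mem u hu =>
    obtain ⟨b, rfl⟩ := hu
    have h : (star a * a) ⊗ₜ[ℂ] (star b * b) = star (a ⊗ₜ[ℂ] b) * (a ⊗ₜ[ℂ] b) := by
      rw [TensorProduct.star_tmul, Algebra.TensorProduct.tmul_mul_tmul]
    change 0 ≤ tensorDual φ.toDual σ.toDual (cc.scattering ((star a * a) ⊗ₜ[ℂ] (star b * b)))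
    rw [h, map_mul, map_star]
    exact tensorDual_nonneg φ σ _

/-- The selective state update conditioned on success of the test of `F`: the partial function
`φ ↦ ℐ_σ(F)(φ) / ℐ_σ(F)(φ)(1)` on states, defined where the success probability
`ℐ_σ(F)(φ)(1)` is nonzero. -/
def CoupledCombination.selectiveUpdate (cc : CoupledCombination A B C K) (σ : State ℬ)
    (F : Effect ℬ) : State 𝒜 →. State 𝒜 := fun φ ↦
  { Dom := cc.preInstrument σ F φ.toDual 1 ≠ 0
    get := fun h ↦
      { toDual := (cc.preInstrument σ F φ.toDual 1)⁻¹ • cc.preInstrument σ F φ.toDual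
        map_one := inv_mul_cancel₀ h
        nonneg := fun a ↦ by
          have h₁ : 0 ≤ cc.preInstrument σ F φ.toDual 1 := by
            simpa using cc.preInstrument_nonneg σ F φ 1
          exact mul_nonneg (inv_nonneg.2 h₁) (cc.preInstrument_nonneg σ F φ a) } }

/-- The nonselective state update `φ ↦ ℐ_σ(1)(φ)`. -/
def CoupledCombination.nonselectiveUpdate (cc : CoupledCombination A B C K) (σ : State ℬ)
    (φ : State 𝒜) : State 𝒜 where
  toDual := cc.preInstrument σ (Effect.one ℬ) φ.toDual
  map_one := by
    rw [cc.preInstrument_apply]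
    change tensorDual φ.toDual σ.toDual (cc.scattering 1) = 1
    rw [map_one]
    exact (φ.tensor σ).map_one
  nonneg := cc.preInstrument_nonneg σ (Effect.one ℬ) φ

end QFT

/-! ### Two measurements -/

section TwoProbes

variable {𝒜 ℬ₁ ℬ₂ : Type*} [Ring 𝒜] [Algebra ℂ 𝒜] [Ring ℬ₁] [Algebra ℂ ℬ₁] [Ring ℬ₂] [Algebra ℂ ℬ₂]

/-- `T ⊗ id`, for `T` on `𝒜 ⊗ ℬ₁`, as a map on `𝒜 ⊗ (ℬ₁ ⊗ ℬ₂)`. -/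
def ampFirst (T : 𝒜 ⊗[ℂ] ℬ₁ →ₗ[ℂ] 𝒜 ⊗[ℂ] ℬ₁) :
    𝒜 ⊗[ℂ] (ℬ₁ ⊗[ℂ] ℬ₂) →ₗ[ℂ] 𝒜 ⊗[ℂ] (ℬ₁ ⊗[ℂ] ℬ₂) :=
  (TensorProduct.assoc ℂ 𝒜 ℬ₁ ℬ₂).toLinearMap ∘ₗ TensorProduct.map T LinearMap.id ∘ₗ
    (TensorProduct.assoc ℂ 𝒜 ℬ₁ ℬ₂).symm.toLinearMap

variable (𝒜 ℬ₁ ℬ₂) in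
/-- The identification `(a ⊗ b₂) ⊗ b₁ ↦ (a ⊗ b₂) ⊗₂ b₁ = a ⊗ (b₁ ⊗ b₂)`. -/
def insertSecond : (𝒜 ⊗[ℂ] ℬ₂) ⊗[ℂ] ℬ₁ ≃ₗ[ℂ] 𝒜 ⊗[ℂ] (ℬ₁ ⊗[ℂ] ℬ₂) :=
  TensorProduct.assoc ℂ 𝒜 ℬ₂ ℬ₁ ≪≫ₗ
    TensorProduct.congr (LinearEquiv.refl ℂ 𝒜) (TensorProduct.comm ℂ ℬ₂ ℬ₁)

/-- `T ⊗₂ id`, for `T` on `𝒜 ⊗ ℬ₂`, as a map on `𝒜 ⊗ (ℬ₁ ⊗ ℬ₂)`. -/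
def ampSecond (T : 𝒜 ⊗[ℂ] ℬ₂ →ₗ[ℂ] 𝒜 ⊗[ℂ] ℬ₂) :
    𝒜 ⊗[ℂ] (ℬ₁ ⊗[ℂ] ℬ₂) →ₗ[ℂ] 𝒜 ⊗[ℂ] (ℬ₁ ⊗[ℂ] ℬ₂) :=
  (insertSecond 𝒜 ℬ₁ ℬ₂).toLinearMap ∘ₗ TensorProduct.map T LinearMap.id ∘ₗ
    (insertSecond 𝒜 ℬ₁ ℬ₂).symm.toLinearMap

end TwoProbes

section CausalFactorisation

variable {d : ℕ} {M : Type*} [TopologicalSpace M]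
  [ChartedSpace (EuclideanSpace ℝ (Fin (d + 1))) M] [IsManifold (𝓡 (d + 1)) ∞ M]
  {S : Spacetime d M} {𝒜 ℬ₁ ℬ₂ 𝒞₁ 𝒞₂ 𝒞 : Type*}
  [Ring 𝒜] [StarRing 𝒜] [Algebra ℂ 𝒜] [StarModule ℂ 𝒜]
  [Ring ℬ₁] [StarRing ℬ₁] [Algebra ℂ ℬ₁] [StarModule ℂ ℬ₁]
  [Ring ℬ₂] [StarRing ℬ₂] [Algebra ℂ ℬ₂] [StarModule ℂ ℬ₂]
  [Ring 𝒞₁] [StarRing 𝒞₁] [Algebra ℂ 𝒞₁] [StarModule ℂ 𝒞₁]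
  [Ring 𝒞₂] [StarRing 𝒞₂] [Algebra ℂ 𝒞₂] [StarModule ℂ 𝒞₂]
  [Ring 𝒞] [StarRing 𝒞] [Algebra ℂ 𝒞] [StarModule ℂ 𝒞]
  {A : QFT S 𝒜} {B₁ : QFT S ℬ₁} {B₂ : QFT S ℬ₂} {C₁ : QFT S 𝒞₁} {C₂ : QFT S 𝒞₂} {C : QFT S 𝒞}
  {K₁ K₂ : Set M}

/-- Causal factorisation of the combined scattering map: for every causal order that the coupling
zones admit, `Θ` is the corresponding composition of the individual scattering maps. -/
structure CausalFactorisation (cc₁ : CoupledCombination A B₁ C₁ K₁)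
    (cc₂ : CoupledCombination A B₂ C₂ K₂)
    (cc : CoupledCombination A (B₁.tensor B₂) C (K₁ ∪ K₂)) : Prop where
  first_second : S.CausallyPrecedes K₁ K₂ →
    cc.scatteringₗ = ampFirst cc₁.scatteringₗ ∘ₗ ampSecond cc₂.scatteringₗ
  second_first : S.CausallyPrecedes K₂ K₁ →
    cc.scatteringₗ = ampSecond cc₂.scatteringₗ ∘ₗ ampFirst cc₁.scatteringₗ

end CausalFactorisation

end AQFT

end

open AQFT

/-! A pre-instrument is the dual of the map `heisenberg`, A ↦ η_σ(Θ(A ⊗ F)), on the system algebra.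
If K₁ ◁ K₂, then Θ = (Θ₁ ⊗ id) ∘ (Θ₂ ⊗₂ id) sends A ⊗ E₁ ⊗ E₂ first through Θ₂, which ignores E₁. As
Θ₁ does not touch the second probe, averaging that probe in σ₂ may be done before Θ₁ acts
(`eta_ampFirst_insertSecond`). The combined Heisenberg map is therefore the first probe's applied
after the second's, and dualising reverses the order. Causal disjointness admits both causal orders,
so the mirror computation (`eta_ampSecond_assoc`) gives the same combined pre-instrument.

For selective updates (`CoupledCombination.selectiveUpdate_comp`), linearity of the pre-instruments
makes the intermediate normalisation cancel. The remaining issue is the domain: the combined update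
must be undefined whenever the first update is. The combined probabilities for an effect and for its
complement are nonnegative and sum to the first probability, so both vanish when it does. -/

namespace AQFT

/-! ### Causal disjointness yields both causal orders -/

namespace Spacetime

variable {d : ℕ} {M : Type*} [TopologicalSpace M]
  [ChartedSpace (EuclideanSpace ℝ (Fin (d + 1))) M] [IsManifold (𝓡 (d + 1)) ∞ M]
  {S : Spacetime d M} {X Y : Set M}

theorem CausallyDisjoint.causallyPrecedes (h : S.CausallyDisjoint X Y) :
    S.CausallyPrecedes X Y :=
  Set.subset_empty_iff.1 fun _ hx ↦ h.subset ⟨hx.1, Or.inl hx.2⟩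

/-- A causal curve witnessing a point of one set in the future of the other also witnesses the
reverse relation in the past, so `JPlus` and `JMinus` swap roles. Common points are excluded because
`J Y` contains `Y`. -/
theorem CausallyDisjoint.symm (h : S.CausallyDisjoint X Y) : S.CausallyDisjoint Y X := by
  refine Set.subset_empty_iff.1 ?_
  rintro y ⟨hy, (hyX | ⟨x, hx, hxy⟩) | (hyX | ⟨x, hx, hyx⟩)⟩
  · exact h.subset ⟨hyX, Or.inl (Or.inl hy)⟩
  · exact absurd (show x ∈ X ∩ S.J Y from ⟨hx, Or.inr (Or.inr ⟨y, hy, hxy⟩)⟩)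
      (Set.eq_empty_iff_forall_notMem.1 h x)
  · exact h.subset ⟨hyX, Or.inl (Or.inl hy)⟩
  · exact absurd (show x ∈ X ∩ S.J Y from ⟨hx, Or.inl (Or.inr ⟨y, hy, hyx⟩)⟩)
      (Set.eq_empty_iff_forall_notMem.1 h x)

end Spacetime

/-! ### Partial averaging over probes and amplified scattering maps -/

section StarAlgebra

set_option linter.unusedSectionVars false

variable {𝒜 ℬ₁ ℬ₂ : Type*} [Ring 𝒜] [StarRing 𝒜] [Algebra ℂ 𝒜] [StarModule ℂ 𝒜]
  [Ring ℬ₁] [StarRing ℬ₁] [Algebra ℂ ℬ₁] [StarModule ℂ ℬ₁]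
  [Ring ℬ₂] [StarRing ℬ₂] [Algebra ℂ ℬ₂] [StarModule ℂ ℬ₂]

/-- The complementary effect `1 - E`. -/
def Effect.compl (E : Effect 𝒜) : Effect 𝒜 where
  val := 1 - E.val
  pos := E.compl_pos
  compl_pos := by simpa using E.pos

theorem State.ext {φ ψ : State 𝒜} (h : φ.toDual = ψ.toDual) : φ = ψ := by
  cases φ; cases ψ; cases h; rfl

@[simp] theorem eta_tmul (σ : State ℬ₁) (a : 𝒜) (b : ℬ₁) :
    eta σ (a ⊗ₜ[ℂ] b) = σ.toDual b • a := by simp [eta]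

/-- A Fubini rule: averaging in a product state may be done one probe at a time. The element `x` is
arbitrary because scattering does not preserve simple tensors. -/
theorem eta_tensor_assoc (σ₁ : State ℬ₁) (σ₂ : State ℬ₂) (x : 𝒜 ⊗[ℂ] ℬ₁) (b : ℬ₂) :
    eta (σ₁.tensor σ₂) (TensorProduct.assoc ℂ 𝒜 ℬ₁ ℬ₂ (x ⊗ₜ b)) = σ₂.toDual b • eta σ₁ x := by
  induction x with
  | zero => simp
  | add x y hx hy => rw [TensorProduct.add_tmul, map_add, map_add, hx, hy, map_add, smul_add]
  | tmul a c => simp [State.tensor, smul_smul, mul_comm]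

theorem eta_tensor_insertSecond (σ₁ : State ℬ₁) (σ₂ : State ℬ₂) (x : 𝒜 ⊗[ℂ] ℬ₂) (b : ℬ₁) :
    eta (σ₁.tensor σ₂) (insertSecond 𝒜 ℬ₁ ℬ₂ (x ⊗ₜ b)) = σ₁.toDual b • eta σ₂ x := by
  induction x with
  | zero => simp
  | add x y hx hy => rw [TensorProduct.add_tmul, map_add, map_add, hx, hy, map_add, smul_add]
  | tmul a c => simp [insertSecond, State.tensor, smul_smul]

theorem ampFirst_tmul (T : 𝒜 ⊗[ℂ] ℬ₁ →ₗ[ℂ] 𝒜 ⊗[ℂ] ℬ₁) (a : 𝒜) (b : ℬ₁) (c : ℬ₂) :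
    ampFirst T (a ⊗ₜ (b ⊗ₜ c)) = TensorProduct.assoc ℂ 𝒜 ℬ₁ ℬ₂ (T (a ⊗ₜ b) ⊗ₜ c) := by
  simp [ampFirst]

theorem ampSecond_tmul (T : 𝒜 ⊗[ℂ] ℬ₂ →ₗ[ℂ] 𝒜 ⊗[ℂ] ℬ₂) (a : 𝒜) (b : ℬ₁) (c : ℬ₂) :
    ampSecond T (a ⊗ₜ (b ⊗ₜ c)) = insertSecond 𝒜 ℬ₁ ℬ₂ (T (a ⊗ₜ c) ⊗ₜ b) := by
  simp [ampSecond, insertSecond]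

/-- The algebraic core: `T` acts trivially on the second probe, so it commutes with averaging that
probe in `σ₂`. In the application `x` is the output of the second scattering map and `b` the effect
of the first probe, still untouched. -/
theorem eta_ampFirst_insertSecond (σ₁ : State ℬ₁) (σ₂ : State ℬ₂)
    (T : 𝒜 ⊗[ℂ] ℬ₁ →ₗ[ℂ] 𝒜 ⊗[ℂ] ℬ₁) (x : 𝒜 ⊗[ℂ] ℬ₂) (b : ℬ₁) :
    eta (σ₁.tensor σ₂) (ampFirst T (insertSecond 𝒜 ℬ₁ ℬ₂ (x ⊗ₜ b))) =
      eta σ₁ (T (eta σ₂ x ⊗ₜ b)) := by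
  induction x with
  | zero => simp
  | add x y hx hy => simp only [TensorProduct.add_tmul, map_add, hx, hy]
  | tmul a c =>
    have h : insertSecond 𝒜 ℬ₁ ℬ₂ ((a ⊗ₜ c) ⊗ₜ b) = a ⊗ₜ (b ⊗ₜ c) := by simp [insertSecond]
    rw [h, ampFirst_tmul, eta_tensor_assoc, eta_tmul, ← TensorProduct.smul_tmul', map_smul,
      map_smul]

theorem eta_ampSecond_assoc (σ₁ : State ℬ₁) (σ₂ : State ℬ₂)
    (T : 𝒜 ⊗[ℂ] ℬ₂ →ₗ[ℂ] 𝒜 ⊗[ℂ] ℬ₂) (x : 𝒜 ⊗[ℂ] ℬ₁) (c : ℬ₂) :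
    eta (σ₁.tensor σ₂) (ampSecond T (TensorProduct.assoc ℂ 𝒜 ℬ₁ ℬ₂ (x ⊗ₜ c))) =
      eta σ₂ (T (eta σ₁ x ⊗ₜ c)) := by
  induction x with
  | zero => simp
  | add x y hx hy => simp only [TensorProduct.add_tmul, map_add, hx, hy]
  | tmul a b =>
    rw [TensorProduct.assoc_tmul, ampSecond_tmul, eta_tensor_insertSecond, eta_tmul,
      ← TensorProduct.smul_tmul', map_smul, map_smul]

end StarAlgebra

/-! ### Composition of pre-instruments and of state updates -/

section Measurements

variable {d : ℕ} {M : Type*} [TopologicalSpace M]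
  [ChartedSpace (EuclideanSpace ℝ (Fin (d + 1))) M] [IsManifold (𝓡 (d + 1)) ∞ M]
  {S : Spacetime d M} {𝒜 ℬ₁ ℬ₂ ℬ 𝒞₁ 𝒞₂ 𝒞 : Type*}
  [Ring 𝒜] [StarRing 𝒜] [Algebra ℂ 𝒜] [StarModule ℂ 𝒜]
  [Ring ℬ₁] [StarRing ℬ₁] [Algebra ℂ ℬ₁] [StarModule ℂ ℬ₁]
  [Ring ℬ₂] [StarRing ℬ₂] [Algebra ℂ ℬ₂] [StarModule ℂ ℬ₂]
  [Ring ℬ] [StarRing ℬ] [Algebra ℂ ℬ] [StarModule ℂ ℬ]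
  [Ring 𝒞₁] [StarRing 𝒞₁] [Algebra ℂ 𝒞₁] [StarModule ℂ 𝒞₁]
  [Ring 𝒞₂] [StarRing 𝒞₂] [Algebra ℂ 𝒞₂] [StarModule ℂ 𝒞₂]
  [Ring 𝒞] [StarRing 𝒞] [Algebra ℂ 𝒞] [StarModule ℂ 𝒞]
  {A : QFT S 𝒜} {B₁ : QFT S ℬ₁} {B₂ : QFT S ℬ₂} {B : QFT S ℬ}
  {C₁ : QFT S 𝒞₁} {C₂ : QFT S 𝒞₂} {C : QFT S 𝒞} {K₁ K₂ K : Set M}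

theorem CausalFactorisation.preInstrument_second_comp_first
    {cc₁ : CoupledCombination A B₁ C₁ K₁} {cc₂ : CoupledCombination A B₂ C₂ K₂}
    {cc : CoupledCombination A (B₁.tensor B₂) C (K₁ ∪ K₂)}
    (hcf : CausalFactorisation cc₁ cc₂ cc) (h : S.CausallyPrecedes K₁ K₂)
    (σ₁ : State ℬ₁) (σ₂ : State ℬ₂) (E₁ : Effect ℬ₁) (E₂ : Effect ℬ₂) :
    cc₂.preInstrument σ₂ E₂ ∘ₗ cc₁.preInstrument σ₁ E₁ =
      cc.preInstrument (σ₁.tensor σ₂) (E₁.tensor E₂) := by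
  ext φ a
  -- Dualisation reverses composition: the measurement performed first has its Heisenberg map
  -- applied last, matching the order in the factorisation of Θ.
  change φ (eta σ₁ (cc₁.scatteringₗ (eta σ₂ (cc₂.scatteringₗ (a ⊗ₜ E₂.val)) ⊗ₜ E₁.val))) =
    φ (eta (σ₁.tensor σ₂) (cc.scatteringₗ (a ⊗ₜ (E₁.val ⊗ₜ E₂.val))))
  rw [hcf.first_second h, LinearMap.comp_apply, ampSecond_tmul, eta_ampFirst_insertSecond]

theorem CausalFactorisation.preInstrument_first_comp_second
    {cc₁ : CoupledCombination A B₁ C₁ K₁} {cc₂ : CoupledCombination A B₂ C₂ K₂}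
    {cc : CoupledCombination A (B₁.tensor B₂) C (K₁ ∪ K₂)}
    (hcf : CausalFactorisation cc₁ cc₂ cc) (h : S.CausallyPrecedes K₂ K₁)
    (σ₁ : State ℬ₁) (σ₂ : State ℬ₂) (E₁ : Effect ℬ₁) (E₂ : Effect ℬ₂) :
    cc₁.preInstrument σ₁ E₁ ∘ₗ cc₂.preInstrument σ₂ E₂ =
      cc.preInstrument (σ₁.tensor σ₂) (E₁.tensor E₂) := by
  ext φ a
  change φ (eta σ₂ (cc₂.scatteringₗ (eta σ₁ (cc₁.scatteringₗ (a ⊗ₜ E₁.val)) ⊗ₜ E₂.val))) =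
    φ (eta (σ₁.tensor σ₂) (cc.scatteringₗ (a ⊗ₜ (E₁.val ⊗ₜ E₂.val))))
  rw [hcf.second_first h, LinearMap.comp_apply, ampFirst_tmul, eta_ampSecond_assoc]

/-- The success probabilities of an effect and of its complement add up to the total. -/
theorem CoupledCombination.preInstrument_one_add_compl (cc : CoupledCombination A B C K)
    (σ : State ℬ) (F : Effect ℬ) (φ : Module.Dual ℂ 𝒜) :
    cc.preInstrument σ F φ 1 + cc.preInstrument σ F.compl φ 1 = φ 1 := by
  rw [cc.preInstrument_apply, cc.preInstrument_apply, ← map_add, ← map_add,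
    ← TensorProduct.tmul_add]
  simp only [Effect.compl, add_sub_cancel]
  -- The effects sum to 1, and Θ is unital; positivity of `φ` plays no role, so unnormalised
  -- functionals are covered.
  rw [← Algebra.TensorProduct.one_def, map_one, Algebra.TensorProduct.one_def, tensorDual_tmul,
    σ.map_one, mul_one]

theorem CoupledCombination.preInstrument_one_nonneg (cc : CoupledCombination A B C K)
    (σ : State ℬ) (F : Effect ℬ) (φ : State 𝒜) : 0 ≤ cc.preInstrument σ F φ.toDual 1 := by
  simpa using cc.preInstrument_nonneg σ F φ 1

/-- If the pre-instruments of two successive measurements compose to those of a third one, then so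
do the selective updates. -/
theorem CoupledCombination.selectiveUpdate_comp
    (cc₁ : CoupledCombination A B₁ C₁ K₁) (cc₂ : CoupledCombination A B₂ C₂ K₂)
    (cc : CoupledCombination A B C K) (σ₁ : State ℬ₁) (σ₂ : State ℬ₂) (σ : State ℬ)
    (E₁ : Effect ℬ₁) (E₂ : Effect ℬ₂) (G : Effect ℬ₂ → Effect ℬ)
    (h : ∀ F, cc₂.preInstrument σ₂ F ∘ₗ cc₁.preInstrument σ₁ E₁ = cc.preInstrument σ (G F)) :
    (cc₂.selectiveUpdate σ₂ E₂).comp (cc₁.selectiveUpdate σ₁ E₁) =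
      cc.selectiveUpdate σ (G E₂) := by
  funext φ
  -- All effects `F` are needed, not only `E₂`: the domain argument also uses the complement of
  -- `E₂`.
  have h' (F : Effect ℬ₂) : cc₂.preInstrument σ₂ F (cc₁.preInstrument σ₁ E₁ φ.toDual) =
      cc.preInstrument σ (G F) φ.toDual := LinearMap.congr_fun (h F) φ.toDual
  have hfirst : cc.preInstrument σ (G E₂) φ.toDual 1 ≠ 0 →
      cc₁.preInstrument σ₁ E₁ φ.toDual 1 ≠ 0 := by
    intro hne h0
    have hsum := cc₂.preInstrument_one_add_compl σ₂ E₂ (cc₁.preInstrument σ₁ E₁ φ.toDual)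
    -- Rewriting through the combined measurement makes both summands values at the state `φ`, where
    -- nonnegativity is available; the intermediate functional is not a state here.
    rw [h', h', h0] at hsum
    exact hne ((add_eq_zero_iff_of_nonneg (cc.preInstrument_one_nonneg σ _ φ)
      (cc.preInstrument_one_nonneg σ _ φ)).1 hsum).1
  have hscale (c : ℂ) : cc₂.preInstrument σ₂ E₂ (c • cc₁.preInstrument σ₁ E₁ φ.toDual) =
      c • cc.preInstrument σ (G E₂) φ.toDual := by rw [map_smul, h']
  refine Part.ext' ⟨?_, fun hne ↦ ⟨hfirst hne, ?_⟩⟩ ?_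
  · rintro ⟨h₁, h₂⟩ h0
    refine h₂ ?_
    change cc₂.preInstrument σ₂ E₂ ((cc₁.preInstrument σ₁ E₁ φ.toDual 1)⁻¹ •
      cc₁.preInstrument σ₁ E₁ φ.toDual) 1 = 0
    rw [hscale, LinearMap.smul_apply, h0, smul_zero]
  · change cc₂.preInstrument σ₂ E₂ ((cc₁.preInstrument σ₁ E₁ φ.toDual 1)⁻¹ •
      cc₁.preInstrument σ₁ E₁ φ.toDual) 1 ≠ 0
    rw [hscale, LinearMap.smul_apply]
    exact smul_ne_zero (inv_ne_zero (hfirst hne)) hne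
  · rintro ⟨h₁, -⟩ hne
    have hc : cc₁.preInstrument σ₁ E₁ φ.toDual 1 ≠ 0 := h₁
    apply State.ext
    change (cc₂.preInstrument σ₂ E₂ ((cc₁.preInstrument σ₁ E₁ φ.toDual 1)⁻¹ •
        cc₁.preInstrument σ₁ E₁ φ.toDual) 1)⁻¹ •
      cc₂.preInstrument σ₂ E₂ ((cc₁.preInstrument σ₁ E₁ φ.toDual 1)⁻¹ •
        cc₁.preInstrument σ₁ E₁ φ.toDual) =
      (cc.preInstrument σ (G E₂) φ.toDual 1)⁻¹ • cc.preInstrument σ (G E₂) φ.toDual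
    -- With c the first success probability, the factor c⁻¹ occurs in both the functional and its
    -- normalisation, and cancels.
    rw [hscale, LinearMap.smul_apply, smul_smul, smul_eq_mul, mul_inv, inv_inv, mul_right_comm,
      mul_inv_cancel₀ hc, one_mul]

theorem CoupledCombination.nonselectiveUpdate_comp
    (cc₁ : CoupledCombination A B₁ C₁ K₁) (cc₂ : CoupledCombination A B₂ C₂ K₂)
    (cc : CoupledCombination A B C K) (σ₁ : State ℬ₁) (σ₂ : State ℬ₂) (σ : State ℬ)
    (h : cc₂.preInstrument σ₂ (Effect.one ℬ₂) ∘ₗ cc₁.preInstrument σ₁ (Effect.one ℬ₁) =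
      cc.preInstrument σ (Effect.one ℬ)) :
    cc₂.nonselectiveUpdate σ₂ ∘ cc₁.nonselectiveUpdate σ₁ = cc.nonselectiveUpdate σ :=
  funext fun φ ↦ State.ext (LinearMap.congr_fun h φ.toDual)

end Measurements

end AQFT

theorem mainTheorem2
    {d : ℕ} {M : Type*} [TopologicalSpace M] [T2Space M] [SecondCountableTopology M]
    [ChartedSpace (EuclideanSpace ℝ (Fin (d + 1))) M] [IsManifold (𝓡 (d + 1)) ∞ M]
    (S : Spacetime d M) (hS : S.IsGloballyHyperbolic)
    {𝒜 ℬ₁ ℬ₂ 𝒞₁ 𝒞₂ 𝒞 : Type*}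
    [Ring 𝒜] [StarRing 𝒜] [Algebra ℂ 𝒜] [StarModule ℂ 𝒜]
    [Ring ℬ₁] [StarRing ℬ₁] [Algebra ℂ ℬ₁] [StarModule ℂ ℬ₁]
    [Ring ℬ₂] [StarRing ℬ₂] [Algebra ℂ ℬ₂] [StarModule ℂ ℬ₂]
    [Ring 𝒞₁] [StarRing 𝒞₁] [Algebra ℂ 𝒞₁] [StarModule ℂ 𝒞₁]
    [Ring 𝒞₂] [StarRing 𝒞₂] [Algebra ℂ 𝒞₂] [StarModule ℂ 𝒞₂]
    [Ring 𝒞] [StarRing 𝒞] [Algebra ℂ 𝒞] [StarModule ℂ 𝒞]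
    (A : QFT S 𝒜) (B₁ : QFT S ℬ₁) (B₂ : QFT S ℬ₂)
    (C₁ : QFT S 𝒞₁) (C₂ : QFT S 𝒞₂) (C : QFT S 𝒞)
    (K₁ K₂ : Set M)
    (cc₁ : CoupledCombination A B₁ C₁ K₁) (cc₂ : CoupledCombination A B₂ C₂ K₂)
    (cc : CoupledCombination A (B₁.tensor B₂) C (K₁ ∪ K₂))
    (hcf : CausalFactorisation cc₁ cc₂ cc)
    (hK : S.CausallyDisjoint K₁ K₂)
    (σ₁ : State ℬ₁) (σ₂ : State ℬ₂) (E₁ : Effect ℬ₁) (E₂ : Effect ℬ₂) :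
    (cc₂.preInstrument σ₂ E₂ ∘ₗ cc₁.preInstrument σ₁ E₁ =
        cc.preInstrument (σ₁.tensor σ₂) (E₁.tensor E₂) ∧
      cc.preInstrument (σ₁.tensor σ₂) (E₁.tensor E₂) =
        cc₁.preInstrument σ₁ E₁ ∘ₗ cc₂.preInstrument σ₂ E₂) ∧
    ((cc₂.selectiveUpdate σ₂ E₂).comp (cc₁.selectiveUpdate σ₁ E₁) =
        cc.selectiveUpdate (σ₁.tensor σ₂) (E₁.tensor E₂) ∧
      cc.selectiveUpdate (σ₁.tensor σ₂) (E₁.tensor E₂) =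
        (cc₁.selectiveUpdate σ₁ E₁).comp (cc₂.selectiveUpdate σ₂ E₂)) ∧
    (cc₂.nonselectiveUpdate σ₂ ∘ cc₁.nonselectiveUpdate σ₁ =
        cc.nonselectiveUpdate (σ₁.tensor σ₂) ∧
      cc.nonselectiveUpdate (σ₁.tensor σ₂) =
        cc₁.nonselectiveUpdate σ₁ ∘ cc₂.nonselectiveUpdate σ₂) := by
  have h₁₂ := hcf.preInstrument_second_comp_first hK.causallyPrecedes σ₁ σ₂
  have h₂₁ := hcf.preInstrument_first_comp_second hK.symm.causallyPrecedes σ₁ σ₂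
  exact ⟨⟨h₁₂ E₁ E₂, (h₂₁ E₁ E₂).symm⟩,
    -- The effect of the measurement performed first is held fixed, while that of the later one
    -- varies; this determines the slot filled in `G`.
    ⟨cc₁.selectiveUpdate_comp cc₂ cc σ₁ σ₂ _ E₁ E₂ (E₁.tensor ·) (h₁₂ E₁),
      (cc₂.selectiveUpdate_comp cc₁ cc σ₂ σ₁ _ E₂ E₁ (·.tensor E₂) (h₂₁ · E₂)).symm⟩,
    -- The product of the two trivial effects is the trivial effect by definition, since the unit of
    -- the tensor product is 1 ⊗ 1.
    ⟨cc₁.nonselectiveUpdate_comp cc₂ cc σ₁ σ₂ _ (h₁₂ _ _),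
      (cc₂.nonselectiveUpdate_comp cc₁ cc σ₂ σ₁ _ (h₂₁ _ _)).symm⟩⟩
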